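/- Let $\kappa\in\mathbb{R}$ and let $(M_\kappa,d_\kappa)$ be the model plane of constant curvature $\kappa$: the Euclidean plane if $\kappa=0$, the unit sphere $S^2$ with its angular metric multiplied by $1/\sqrt{\kappa}$ if $\kappa>0$, and the hyperbolic plane of curvature $-1$ with its metric multiplied by $1/\sqrt{-\kappa}$ if $\kappa<0$. Call a triangle $(a_1,a_2,a_3)$ in a metric space $(X,d)$ (that is, a triple of points) *small* if $\kappa\le 0$, or if $\kappa>0$ and $d(a_1,a_2)+d(a_2,a_3)+d(a_3,a_1)<2\pi/\sqrt{\kappa}$. A *comparison triangle* for it is a triple $(\overline a_1,\overline a_2,\overline a_3)$ in $M_\kappa$ with $d_\kappa(\overline a_i,\overline a_j)=d(a_i,a_j)$ for all $i,j$. A metric space $(X,d)$ is a $\mathrm{CAT}(\kappa)$ space if any two points of $X$ (at distance less than $\pi/\sqrt{\kappa}$ if $\kappa>0$) are joined by a geodesic and, for every geodesic triangle in $X$ whose vertices form a small triangle, the distance between any two points on its sides is at most the distance between the corresponding points on the sides of a comparison triangle in $M_\kappa$. The *circumradius* of a triple in a metric space $(Y,d_Y)$ is $$r(a_1,a_2,a_3)=\inf_{y\in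 Y}\ \max_{i=1,2,3} d_Y(y,a_i).$$ We say that $\operatorname{Curv} X\le\kappa$ if $r(a_1,a_2,a_3)\le r(\overline a_1,\overline a_2,\overline a_3)$ for every small triangle $(a_1,a_2,a_3)$ in $X$ and every comparison triangle $(\overline a_1,\overline a_2,\overline a_3)$ for it in $M_\kappa$, where the left circumradius is taken in $X$ and the right one in $M_\kappa$. **Theorem.** Let $\kappa\in\mathbb{R}$ and let $(X,d)$ be a $\mathrm{CAT}(\kappa)$ space. Then $\operatorname{Curv} X\le\kappa$. -/

import Mathlib

noncomputable section

/-- The three simply connected surfaces of constant curvature `1`, `0`, `-1`: the unit sphere in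
`ℝ³`, the Euclidean plane, and the hyperbolic plane (upper half-plane model). -/
def UnitModelPlane : SignType → Type
  | .pos => Metric.sphere (0 : EuclideanSpace ℝ (Fin 3)) 1
  | .zero => EuclideanSpace ℝ (Fin 2)
  | .neg => UpperHalfPlane

/-- The intrinsic distance of the unit models: the angular distance on the sphere, the Euclidean
distance on the plane, the hyperbolic distance on the upper half-plane. -/
def UnitModelPlane.intrinsicDist : (s : SignType) → UnitModelPlane s → UnitModelPlane s → ℝ
  | .pos => fun (x y : Metric.sphere (0 : EuclideanSpace ℝ (Fin 3)) 1) =>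
      InnerProductGeometry.angle (x : EuclideanSpace ℝ (Fin 3)) (y : EuclideanSpace ℝ (Fin 3))
  | .zero => fun (x y : EuclideanSpace ℝ (Fin 2)) => dist x y
  | .neg => fun (x y : UpperHalfPlane) => dist x y

/-- The points of the model plane `M_κ` of constant curvature `κ`. -/
def ModelPlane (κ : ℝ) : Type := UnitModelPlane (SignType.sign κ)

/-- The factor by which the unit model is rescaled: `1 / √|κ|` for `κ ≠ 0`, and `1` for `κ = 0`. -/
def modelScale (κ : ℝ) : ℝ := if κ = 0 then 1 else 1 / √|κ|

theorem modelScale_pos (κ : ℝ) : 0 < modelScale κ := by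
  unfold modelScale
  split_ifs with h
  · exact one_pos
  · have := Real.sqrt_pos.mpr (abs_pos.mpr h)
    positivity

namespace UnitModelPlane

theorem intrinsicDist_self (s : SignType) (x : UnitModelPlane s) : intrinsicDist s x x = 0 := by
  cases s with
  | zero => exact dist_self (α := EuclideanSpace ℝ (Fin 2)) x
  | neg => exact dist_self (α := UpperHalfPlane) x
  | pos =>
    exact InnerProductGeometry.angle_self
      (ne_zero_of_mem_unit_sphere (x : Metric.sphere (0 : EuclideanSpace ℝ (Fin 3)) 1))

theorem intrinsicDist_comm (s : SignType) (x y : UnitModelPlane s) :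
    intrinsicDist s x y = intrinsicDist s y x := by
  cases s with
  | zero => exact dist_comm (α := EuclideanSpace ℝ (Fin 2)) x y
  | neg => exact dist_comm (α := UpperHalfPlane) x y
  | pos => exact InnerProductGeometry.angle_comm _ _

theorem intrinsicDist_triangle (s : SignType) (x y z : UnitModelPlane s) :
    intrinsicDist s x z ≤ intrinsicDist s x y + intrinsicDist s y z := by
  cases s with
  | zero => exact dist_triangle (α := EuclideanSpace ℝ (Fin 2)) x y z
  | neg => exact dist_triangle (α := UpperHalfPlane) x y z
  | pos => exact InnerProductGeometry.angle_le_angle_add_angle _ _ _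

theorem eq_of_intrinsicDist_eq_zero (s : SignType) (x y : UnitModelPlane s)
    (h : intrinsicDist s x y = 0) : x = y := by
  cases s with
  | zero => exact eq_of_dist_eq_zero (γ := EuclideanSpace ℝ (Fin 2)) h
  | neg => exact eq_of_dist_eq_zero (γ := UpperHalfPlane) h
  | pos =>
    obtain ⟨-, r, hr, hy⟩ := InnerProductGeometry.angle_eq_zero_iff.mp h
    have hx1 : ‖(x : Metric.sphere (0 : EuclideanSpace ℝ (Fin 3)) 1).1‖ = 1 :=
      norm_eq_of_mem_sphere (x : Metric.sphere (0 : EuclideanSpace ℝ (Fin 3)) 1)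
    have hy1 : ‖(y : Metric.sphere (0 : EuclideanSpace ℝ (Fin 3)) 1).1‖ = 1 :=
      norm_eq_of_mem_sphere (y : Metric.sphere (0 : EuclideanSpace ℝ (Fin 3)) 1)
    rw [hy, norm_smul, hx1, mul_one, Real.norm_of_nonneg hr.le] at hy1
    rw [hy1, one_smul] at hy
    exact Subtype.ext hy.symm

end UnitModelPlane

/-- The model plane `(M_κ, d_κ)` as a metric space: for `κ > 0` the unit sphere with the angular
metric multiplied by `1 / √κ`, for `κ = 0` the Euclidean plane, for `κ < 0` the hyperbolic plane
of curvature `-1` with the metric multiplied by `1 / √(-κ)`. -/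
instance ModelPlane.instMetricSpace (κ : ℝ) : MetricSpace (ModelPlane κ) where
  dist x y := modelScale κ * UnitModelPlane.intrinsicDist (SignType.sign κ) x y
  dist_self x :=
    mul_eq_zero_of_right _ (UnitModelPlane.intrinsicDist_self (SignType.sign κ) x)
  dist_comm x y :=
    congrArg (modelScale κ * ·) (UnitModelPlane.intrinsicDist_comm (SignType.sign κ) x y)
  dist_triangle x y z :=
    (mul_le_mul_of_nonneg_left (UnitModelPlane.intrinsicDist_triangle (SignType.sign κ) x y z)
      (modelScale_pos κ).le).trans_eq (mul_add _ _ _)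
  eq_of_dist_eq_zero {x y} h :=
    UnitModelPlane.eq_of_intrinsicDist_eq_zero (SignType.sign κ) x y
      ((mul_eq_zero.mp h).resolve_left (modelScale_pos κ).ne')

/-- `γ`, restricted to `[0, 1]`, is a (constant speed, minimizing) geodesic from `x` to `y`. -/
def IsGeodesic {X : Type*} [MetricSpace X] (γ : ℝ → X) (x y : X) : Prop :=
  γ 0 = x ∧ γ 1 = y ∧
    ∀ s ∈ Set.Icc (0 : ℝ) 1, ∀ t ∈ Set.Icc (0 : ℝ) 1, dist (γ s) (γ t) = dist x y * |s - t|

/-- A triangle is small relative to `κ` if `κ ≤ 0`, or if its perimeter is less than `2π / √κ`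
(twice the diameter of `M_κ`). -/
def IsSmallTriangle {X : Type*} [MetricSpace X] (κ : ℝ) (a : Fin 3 → X) : Prop :=
  0 < κ → dist (a 0) (a 1) + dist (a 1) (a 2) + dist (a 2) (a 0) < 2 * Real.pi / √κ

/-- `b` is a comparison triangle in `M_κ` for the triangle `a`. -/
def IsComparisonTriangle {X : Type*} [MetricSpace X] {κ : ℝ} (a : Fin 3 → X)
    (b : Fin 3 → ModelPlane κ) : Prop :=
  ∀ i j, dist (b i) (b j) = dist (a i) (a j)

/-- `x'` is a comparison point in `M_κ`, on a geodesic segment `[p', q']`, for the point `x` on a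
geodesic segment `[p, q]` (where `d_κ(p', q') = d(p, q)`): its distances to the end points are the
same as those of `x`. -/
def IsComparisonPoint {X : Type*} [MetricSpace X] {κ : ℝ} (p q x : X)
    (p' q' x' : ModelPlane κ) : Prop :=
  dist p' x' = dist p x ∧ dist x' q' = dist x q

/-- `X` is a `CAT(κ)` space: any two points (at distance less than `π / √κ` if `κ > 0`) are joined
by a geodesic, and every geodesic triangle (of perimeter less than `2π / √κ` if `κ > 0`), with
sides `γ i` from `a i` to `a (i + 1)`, indices modulo `3`, is not thicker than its comparison
triangle in `M_κ`: distances between points on its sides do not exceed the distances between the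
corresponding comparison points. -/
structure IsCAT (κ : ℝ) (X : Type*) [MetricSpace X] : Prop where
  exists_geodesic : ∀ x y : X, (0 < κ → dist x y < Real.pi / √κ) → ∃ γ : ℝ → X, IsGeodesic γ x y
  comparison : ∀ (a : Fin 3 → X) (γ : Fin 3 → ℝ → X),
    (∀ i, IsGeodesic (γ i) (a i) (a (i + 1))) → IsSmallTriangle κ a →
    ∀ b : Fin 3 → ModelPlane κ, IsComparisonTriangle a b →
    ∀ i j, ∀ s ∈ Set.Icc (0 : ℝ) 1, ∀ t ∈ Set.Icc (0 : ℝ) 1, ∀ x' y' : ModelPlane κ,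
      IsComparisonPoint (a i) (a (i + 1)) (γ i s) (b i) (b (i + 1)) x' →
      IsComparisonPoint (a j) (a (j + 1)) (γ j t) (b j) (b (j + 1)) y' →
      dist (γ i s) (γ j t) ≤ dist x' y'

/-- The circumradius `inf_x max_i d(x, a_i)` of a triangle. -/
def circumradius {X : Type*} [MetricSpace X] (a : Fin 3 → X) : ℝ :=
  ⨅ x : X, max (dist x (a 0)) (max (dist x (a 1)) (dist x (a 2)))

/-- `Curv X ≤ κ`: the circumradius of every triangle in `X` (of perimeter less than `2π / √κ` if
`κ > 0`) is at most the circumradius of its comparison triangles in `M_κ`. -/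
def CurvLE (X : Type*) [MetricSpace X] (κ : ℝ) : Prop :=
  ∀ a : Fin 3 → X, IsSmallTriangle κ a →
    ∀ b : Fin 3 → ModelPlane κ, IsComparisonTriangle a b → circumradius a ≤ circumradius b

end

/-!
Let `o ∈ M_κ` be within `R` of all vertices of a comparison triangle of `a`. Let `p` run along a
geodesic from `a 0` to `a 1`, and let `y` be the point of `[a 2, p]` at distance
`min R (dist (a 2) p)` from `a 2`. Geodesics of a `CAT(κ)` space depend continuously on their end
points, so `y` runs along a path. It starts within `R` of `a 0` and ends within `R` of `a 1`, and
each of its points is within `R` of `a 0` or of `a 1`: comparing distances by Stewart's theorem, a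
suitable average of the functions measuring the distances from `y` to `a 0` and `a 1` is at most the
corresponding average for `o`. As the path is connected, some point of it is within `R` of all three
vertices, hence the circumradius of `a` is at most `R`.

All curvatures are treated at once by measuring lengths through the versine (`1 - cos x`,
`x ^ 2 / 2`, or `cosh x - 1`): then `M_κ` becomes a sheet of a quadric in `ℝ³` on which distances
are polynomial, and Stewart's theorem is linear interpolation along a chord, up to a correction in
one coordinate.
-/

noncomputable section

open Real Filter Topology

/-- The generalized sine of the model surfaces of curvature `1`, `0`, `-1`. -/
def UnitModelPlane.sine : SignType → ℝ → ℝ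
  | .pos => sin
  | .zero => id
  | .neg => sinh

/-- The generalized versine of the model surfaces of curvature `1`, `0`, `-1`: the primitive of
`UnitModelPlane.sine` that vanishes at `0`. -/
def UnitModelPlane.versine : SignType → ℝ → ℝ
  | .pos => fun x => 1 - cos x
  | .zero => fun x => x ^ 2 / 2
  | .neg => fun x => cosh x - 1

/-- The generalized sine of curvature `κ`, as a function of a length measured in `M_κ`. -/
def modelSine (κ x : ℝ) : ℝ := UnitModelPlane.sine (SignType.sign κ) (x / modelScale κ)

/-- The generalized versine of curvature `κ`, as a function of a length measured in `M_κ`. It is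
increasing in the length, and in terms of it the laws of cosines of all model planes take the same
form. -/
def modelVersine (κ x : ℝ) : ℝ := UnitModelPlane.versine (SignType.sign κ) (x / modelScale κ)

/-- The correction term in Stewart's theorem for a point of `M_κ` that divides a segment into parts
of lengths `u` and `v`; for `κ = 0` it is `u * v * (u + v) / 2`. -/
def stewartDefect (κ u v : ℝ) : ℝ :=
  modelSine κ v * modelVersine κ u + modelSine κ u * modelVersine κ v

section ModelFunctions

variable {κ x y : ℝ}

theorem div_modelScale_lt_iff {c : ℝ} (hκ : 0 < κ) : x / modelScale κ < c ↔ x < c / √κ := by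
  rw [div_lt_iff₀ (modelScale_pos κ), modelScale, if_neg hκ.ne', abs_of_pos hκ, mul_one_div]

theorem div_modelScale_le_iff {c : ℝ} (hκ : 0 < κ) : x / modelScale κ ≤ c ↔ x ≤ c / √κ := by
  rw [div_le_iff₀ (modelScale_pos κ), modelScale, if_neg hκ.ne', abs_of_pos hκ, mul_one_div]

theorem sign_eq_pos_iff : SignType.sign κ = .pos ↔ 0 < κ := sign_eq_one_iff

@[simp]
theorem modelSine_zero (κ : ℝ) : modelSine κ 0 = 0 := by
  simp only [modelSine, zero_div]
  cases SignType.sign κ <;> simp [UnitModelPlane.sine]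

@[simp]
theorem modelVersine_zero (κ : ℝ) : modelVersine κ 0 = 0 := by
  simp only [modelVersine, zero_div]
  cases SignType.sign κ <;> simp [UnitModelPlane.versine]

@[simp]
theorem modelSine_neg (κ x : ℝ) : modelSine κ (-x) = -modelSine κ x := by
  simp only [modelSine, neg_div]
  cases SignType.sign κ <;> simp [UnitModelPlane.sine]

@[simp]
theorem modelVersine_neg (κ x : ℝ) : modelVersine κ (-x) = modelVersine κ x := by
  simp only [modelVersine, neg_div]
  cases SignType.sign κ <;> simp [UnitModelPlane.versine]

theorem modelVersine_abs (κ x : ℝ) : modelVersine κ |x| = modelVersine κ x := by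
  rcases abs_choice x with h | h <;> simp [h]

theorem continuous_modelSine (κ : ℝ) : Continuous (modelSine κ) := by
  unfold modelSine
  cases SignType.sign κ <;> simp only [UnitModelPlane.sine, id] <;> fun_prop

theorem continuous_modelVersine (κ : ℝ) : Continuous (modelVersine κ) := by
  unfold modelVersine
  cases SignType.sign κ <;> simp only [UnitModelPlane.versine] <;> fun_prop

theorem modelSine_add (κ u v : ℝ) :
    modelSine κ (u + v) =
      modelSine κ u + modelSine κ v - SignType.sign κ * stewartDefect κ u v := by
  simp only [stewartDefect, modelSine, modelVersine, add_div]
  cases SignType.sign κ <;>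
    simp only [UnitModelPlane.sine, UnitModelPlane.versine, id, sin_add, sinh_add,
      SignType.pos_eq_one, SignType.zero_eq_zero, SignType.neg_eq_neg_one, SignType.coe_one,
      SignType.coe_zero, SignType.coe_neg_one] <;> ring

theorem modelVersine_add (κ u v : ℝ) :
    modelVersine κ (u + v) = modelVersine κ u + modelVersine κ v
      - SignType.sign κ * modelVersine κ u * modelVersine κ v
      + modelSine κ u * modelSine κ v := by
  simp only [modelSine, modelVersine, add_div]
  cases SignType.sign κ <;>
    simp only [UnitModelPlane.sine, UnitModelPlane.versine, id, cos_add, cosh_add,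
      SignType.pos_eq_one, SignType.zero_eq_zero, SignType.neg_eq_neg_one, SignType.coe_one,
      SignType.coe_zero, SignType.coe_neg_one] <;> ring

theorem modelVersine_sub (κ u v : ℝ) :
    modelVersine κ (u - v) = modelVersine κ u + modelVersine κ v
      - SignType.sign κ * modelVersine κ u * modelVersine κ v
      - modelSine κ u * modelSine κ v := by
  rw [sub_eq_add_neg, modelVersine_add, modelVersine_neg, modelSine_neg]
  ring

theorem modelSine_sq (κ x : ℝ) :
    modelSine κ x ^ 2 =
      2 * modelVersine κ x - SignType.sign κ * modelVersine κ x ^ 2 := by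
  have h := modelVersine_sub κ x x
  rw [sub_self, modelVersine_zero] at h
  linear_combination h

theorem modelSine_nonneg (hx : 0 ≤ x) (hκ : 0 < κ → x ≤ π / √κ) : 0 ≤ modelSine κ x := by
  have hx' := div_nonneg hx (modelScale_pos κ).le
  unfold modelSine
  cases h : SignType.sign κ with
  | pos =>
    have hpos := sign_eq_pos_iff.mp h
    exact sin_nonneg_of_nonneg_of_le_pi hx' ((div_modelScale_le_iff hpos).mpr (hκ hpos))
  | zero => exact hx'
  | neg => exact sinh_nonneg_iff.mpr hx'

theorem modelSine_pos (hx : 0 < x) (hκ : 0 < κ → x < π / √κ) : 0 < modelSine κ x := by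
  have hx' := div_pos hx (modelScale_pos κ)
  unfold modelSine
  cases h : SignType.sign κ with
  | pos =>
    have hpos := sign_eq_pos_iff.mp h
    exact sin_pos_of_pos_of_lt_pi hx' ((div_modelScale_lt_iff hpos).mpr (hκ hpos))
  | zero => exact hx'
  | neg => exact sinh_pos_iff.mpr hx'

theorem modelVersine_lt_modelVersine (h : |x| < |y|) (hκ : 0 < κ → |x| + |y| < 2 * π / √κ) :
    modelVersine κ x < modelVersine κ y := by
  have hsub : modelVersine κ |y| - modelVersine κ |x| =
      2 * (modelSine κ ((|y| + |x|) / 2) * modelSine κ ((|y| - |x|) / 2)) := by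
    have hadd := modelVersine_add κ ((|y| + |x|) / 2) ((|y| - |x|) / 2)
    have hsub := modelVersine_sub κ ((|y| + |x|) / 2) ((|y| - |x|) / 2)
    ring_nf at hadd hsub ⊢
    linear_combination hadd - hsub
  have hx := abs_nonneg x
  have hplus : 0 < modelSine κ ((|y| + |x|) / 2) := by
    refine modelSine_pos (by linarith) fun hpos => ?_
    have := hκ hpos
    rw [mul_div_assoc] at this
    linarith
  have hminus : 0 < modelSine κ ((|y| - |x|) / 2) := by
    refine modelSine_pos (by linarith) fun hpos => ?_
    have := hκ hpos
    rw [mul_div_assoc] at this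
    linarith
  rw [← modelVersine_abs κ x, ← modelVersine_abs κ y, ← sub_pos, hsub]
  positivity

theorem modelVersine_le_modelVersine_iff (hκ : 0 < κ → |x| + |y| < 2 * π / √κ) :
    modelVersine κ x ≤ modelVersine κ y ↔ |x| ≤ |y| := by
  refine ⟨fun h => ?_, fun h => ?_⟩
  · by_contra! hlt
    exact h.not_gt (modelVersine_lt_modelVersine hlt fun hpos => add_comm |x| |y| ▸ hκ hpos)
  · rcases h.eq_or_lt with heq | hlt
    · rw [← modelVersine_abs κ x, heq, modelVersine_abs]
    · exact (modelVersine_lt_modelVersine hlt hκ).le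

theorem modelVersine_inj (hx : 0 ≤ x) (hy : 0 ≤ y) (hκ : 0 < κ → x + y < 2 * π / √κ)
    (h : modelVersine κ x = modelVersine κ y) : x = y := by
  rw [← abs_of_nonneg hx, ← abs_of_nonneg hy] at hκ ⊢
  exact le_antisymm ((modelVersine_le_modelVersine_iff hκ).mp h.le)
    ((modelVersine_le_modelVersine_iff fun hpos => add_comm |x| |y| ▸ hκ hpos).mp h.ge)

theorem sq_le_modelVersine (hκ : 0 < κ → |x| ≤ π / √κ) :
    2 / π ^ 2 * (x / modelScale κ) ^ 2 ≤ modelVersine κ x := by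
  have hhalf : 2 / π ^ 2 ≤ 1 / 2 := by
    rw [div_le_div_iff₀ (by positivity) two_pos]
    nlinarith [two_le_pi]
  unfold modelVersine
  set z := x / modelScale κ with hz
  cases h : SignType.sign κ with
  | pos =>
    have hpos := sign_eq_pos_iff.mp h
    have hzπ : |z| ≤ π := by
      rw [hz, abs_div, abs_of_pos (modelScale_pos κ)]
      exact (div_modelScale_le_iff hpos).mpr (hκ hpos)
    exact le_sub_comm.mp (cos_le_one_sub_mul_cos_sq hzπ)
  | zero =>
    simp only [UnitModelPlane.versine]
    nlinarith [sq_nonneg z]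
  | neg =>
    have hsinh : (z / 2) ^ 2 ≤ sinh (z / 2) ^ 2 := by
      rw [sq_le_sq, abs_sinh]
      exact self_le_sinh_iff.mpr (abs_nonneg _)
    have hcosh : cosh z - 1 = 2 * sinh (z / 2) ^ 2 := by
      have := cosh_two_mul (z / 2)
      rw [mul_div_cancel₀ z two_ne_zero, cosh_sq] at this
      linear_combination this
    simp only [UnitModelPlane.versine]
    nlinarith [sq_nonneg z]

theorem modelVersine_nonneg (hκ : 0 < κ → |x| ≤ π / √κ) : 0 ≤ modelVersine κ x :=
  (by positivity : 0 ≤ 2 / π ^ 2 * (x / modelScale κ) ^ 2).trans (sq_le_modelVersine hκ)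

theorem tendsto_zero_of_tendsto_modelVersine {T : Type*} {l : Filter T} {f : T → ℝ}
    (hκ : ∀ᶠ t in l, 0 < κ → |f t| ≤ π / √κ)
    (hf : Tendsto (fun t => modelVersine κ (f t)) l (𝓝 0)) : Tendsto f l (𝓝 0) := by
  have hc : 0 < 2 / π ^ 2 / modelScale κ ^ 2 :=
    div_pos (by positivity) (pow_pos (modelScale_pos κ) 2)
  have hsq : Tendsto (fun t => f t ^ 2) l (𝓝 0) := by
    refine squeeze_zero' (.of_forall fun t => sq_nonneg _) (hκ.mono fun t ht => ?_)
      (by simpa only [zero_div] using hf.div_const (2 / π ^ 2 / modelScale κ ^ 2))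
    rw [le_div_iff₀ hc]
    refine (le_of_eq ?_).trans (sq_le_modelVersine ht)
    ring
  have habs := hsq.sqrt
  simp only [sqrt_sq_eq_abs, sqrt_zero] at habs
  exact (tendsto_zero_iff_abs_tendsto_zero f).mpr habs

theorem modelSine_mul_modelVersine_sub (κ u v z : ℝ) :
    modelSine κ (u + v) * modelVersine κ (z - u) =
      modelSine κ v * modelVersine κ z + modelSine κ u * modelVersine κ (z - (u + v))
        - stewartDefect κ u v := by
  simp only [modelVersine_sub, modelVersine_add, modelSine_add, stewartDefect]
  linear_combination
    -(modelSine κ v * (1 - SignType.sign κ * modelVersine κ z)) * modelSine_sq κ u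

theorem modelSine_sub_mul_stewartDefect (κ u v u' v' : ℝ) :
    (modelSine κ u + modelSine κ v - modelSine κ (u + v)) * stewartDefect κ u' v' =
      (modelSine κ u' + modelSine κ v' - modelSine κ (u' + v')) * stewartDefect κ u v := by
  rw [modelSine_add, modelSine_add]
  ring

end ModelFunctions

section Coordinates

/-- The symmetric biaffine expression that gives the versine of the distance of two points of a
model surface in the coordinates `UnitModelPlane.coords`; these embed the surface in the quadric
`versineForm s P P = 0`. -/
def versineForm (s : SignType) (P Q : Fin 3 → ℝ) : ℝ :=
  P 0 + Q 0 - s * P 0 * Q 0 - P 1 * Q 1 - P 2 * Q 2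

theorem versineForm_comm (s : SignType) (P Q : Fin 3 → ℝ) :
    versineForm s P Q = versineForm s Q P := by
  unfold versineForm
  ring

namespace UnitModelPlane

/-- Coordinates of the model surfaces as quadrics through the origin: the unit sphere translated by
`-e₀` and reflected, the paraboloid `2 * P 0 = P 1 ^ 2 + P 2 ^ 2` over the plane, and the upper
sheet of the hyperboloid translated by `-e₀`. -/
def coords : (s : SignType) → UnitModelPlane s → Fin 3 → ℝ
  | .pos => fun (x : Metric.sphere (0 : EuclideanSpace ℝ (Fin 3)) 1) =>
      ![1 - x.1 0, x.1 1, x.1 2]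
  | .zero => fun (x : EuclideanSpace ℝ (Fin 2)) => ![(x 0 ^ 2 + x 1 ^ 2) / 2, x 0, x 1]
  | .neg => fun (x : UpperHalfPlane) =>
      ![(x.re ^ 2 + x.im ^ 2 + 1) / (2 * x.im) - 1, (x.re ^ 2 + x.im ^ 2 - 1) / (2 * x.im),
        x.re / x.im]

theorem versine_intrinsicDist (s : SignType) (x y : UnitModelPlane s) :
    versine s (intrinsicDist s x y) = versineForm s (coords s x) (coords s y) := by
  cases s with
  | pos =>
    change Metric.sphere (0 : EuclideanSpace ℝ (Fin 3)) 1 at x y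
    simp only [versine, intrinsicDist, versineForm, coords, InnerProductGeometry.cos_angle,
      norm_eq_of_mem_sphere, PiLp.inner_apply, Fin.sum_univ_three]
    simp only [RCLike.inner_apply, ringHom_apply, mul_one, div_one, Matrix.cons_val,
      SignType.pos_eq_one, SignType.coe_one, one_mul]
    ring
  | zero =>
    change EuclideanSpace ℝ (Fin 2) at x y
    simp only [versine, intrinsicDist, EuclideanSpace.dist_eq, Fin.sum_univ_two, Real.dist_eq,
      sq_abs]
    rw [Real.sq_sqrt (by positivity)]
    simp only [versineForm, coords, SignType.zero_eq_zero, SignType.coe_zero, Matrix.cons_val]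
    ring
  | neg =>
    change UpperHalfPlane at x y
    simp only [versine, intrinsicDist, UpperHalfPlane.cosh_dist', versineForm, coords,
      SignType.neg_eq_neg_one, SignType.coe_neg_one, Matrix.cons_val]
    field_simp
    ring

theorem intrinsicDist_le_pi {s : SignType} (hs : s = .pos) (x y : UnitModelPlane s) :
    intrinsicDist s x y ≤ π := by
  subst hs
  exact InnerProductGeometry.angle_le_pi _ _

theorem neg_one_le_coords {s : SignType} (hs : s = .neg) (x : UnitModelPlane s) :
    -1 ≤ coords s x 0 := by
  subst hs
  change UpperHalfPlane at x
  have : 0 ≤ (x.re ^ 2 + x.im ^ 2 + 1) / (2 * x.im) := by positivity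
  simp only [coords, Matrix.cons_val_zero]
  linarith

theorem exists_coords_eq {s : SignType} {P : Fin 3 → ℝ} (hP : versineForm s P P = 0)
    (hs : s = .neg → -1 ≤ P 0) : ∃ x, coords s x = P := by
  cases s with
  | pos =>
    have hP' : (1 - P 0) ^ 2 + P 1 ^ 2 + P 2 ^ 2 = 1 := by
      simp only [versineForm, SignType.pos_eq_one, SignType.coe_one] at hP
      linear_combination -hP
    refine ⟨(⟨!₂[1 - P 0, P 1, P 2], ?_⟩ : Metric.sphere (0 : EuclideanSpace ℝ (Fin 3)) 1), ?_⟩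
    · simp [EuclideanSpace.norm_eq, Fin.sum_univ_three, hP']
    · ext i
      fin_cases i <;> simp [coords]
  | zero =>
    have hP' : (P 1 ^ 2 + P 2 ^ 2) / 2 = P 0 := by
      simp only [versineForm, SignType.zero_eq_zero, SignType.coe_zero] at hP
      linear_combination -hP / 2
    refine ⟨(!₂[P 1, P 2] : EuclideanSpace ℝ (Fin 2)), ?_⟩
    ext i
    fin_cases i <;> simp [coords, hP']
  | neg =>
    have hP' : (1 + P 0) ^ 2 = 1 + P 1 ^ 2 + P 2 ^ 2 := by
      simp only [versineForm, SignType.neg_eq_neg_one, SignType.coe_neg_one] at hP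
      linear_combination hP
    set c := 1 + P 0 - P 1 with hc
    have hc0 : 0 < c := by
      have : |P 1| < 1 + P 0 :=
        abs_lt_of_sq_lt_sq (by linarith [sq_nonneg (P 2)]) (by linarith [hs rfl])
      linarith [le_abs_self (P 1)]
    have hP2 : P 2 ^ 2 + 1 = c * (1 + P 0 + P 1) := by rw [hc]; linear_combination -hP'
    refine ⟨(⟨⟨P 2 / c, 1 / c⟩, by positivity⟩ : UpperHalfPlane), ?_⟩
    ext i
    fin_cases i
    · change ((P 2 / c) ^ 2 + (1 / c) ^ 2 + 1) / (2 * (1 / c)) - 1 = P 0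
      field_simp
      linear_combination hP2 + c * hc
    · change ((P 2 / c) ^ 2 + (1 / c) ^ 2 - 1) / (2 * (1 / c)) = P 1
      field_simp
      linear_combination hP2 - c * hc
    · change P 2 / c / (1 / c) = P 2
      field_simp

end UnitModelPlane

end Coordinates

section ModelPlane

variable {κ : ℝ}

theorem modelSine_mul_versineForm {P X Y : Fin 3 → ℝ} {u v : ℝ}
    (hP : modelSine κ (u + v) • P =
      modelSine κ v • X + modelSine κ u • Y - ![stewartDefect κ u v, 0, 0]) (Z : Fin 3 → ℝ) :
    modelSine κ (u + v) * versineForm (SignType.sign κ) P Z =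
      modelSine κ v * versineForm (SignType.sign κ) X Z
        + modelSine κ u * versineForm (SignType.sign κ) Y Z - stewartDefect κ u v := by
  have h0 : _ * P 0 = _ * X 0 + _ * Y 0 - stewartDefect κ u v := congrFun hP 0
  have h1 : _ * P 1 = _ * X 1 + _ * Y 1 - 0 := congrFun hP 1
  have h2 : _ * P 2 = _ * X 2 + _ * Y 2 - 0 := congrFun hP 2
  unfold versineForm
  linear_combination (1 - SignType.sign κ * Z 0) * h0 - Z 1 * h1 - Z 2 * h2
    + Z 0 * modelSine_add κ u v

theorem exists_mul_eq_and_sq_add_sq_eq {S a c : ℝ} (hc : |c| ≤ S * a) :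
    ∃ x y : ℝ, S * x = c ∧ x ^ 2 + y ^ 2 = a ^ 2 := by
  rcases eq_or_ne S 0 with rfl | hS
  · rw [zero_mul] at hc
    exact ⟨a, 0, by simp [abs_nonpos_iff.mp hc], by ring⟩
  have hx : (c / S) ^ 2 ≤ a ^ 2 := by
    rw [div_pow, div_le_iff₀ (by positivity), ← mul_pow, mul_comm a]
    exact sq_le_sq.mpr (hc.trans (le_abs_self _))
  exact ⟨c / S, √(a ^ 2 - (c / S) ^ 2), mul_div_cancel₀ c hS, by
    rw [sq_sqrt (sub_nonneg.mpr hx)]; ring⟩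

namespace ModelPlane

/-- The coordinates `UnitModelPlane.coords` of a point of `M_κ`. -/
def coords (x : ModelPlane κ) : Fin 3 → ℝ := UnitModelPlane.coords (SignType.sign κ) x

theorem modelVersine_dist (x y : ModelPlane κ) :
    modelVersine κ (dist x y) = versineForm (SignType.sign κ) x.coords y.coords := by
  refine Eq.trans ?_ (UnitModelPlane.versine_intrinsicDist _ x y)
  exact congrArg _ (mul_div_cancel_left₀ _ (modelScale_pos κ).ne')

theorem dist_le (hκ : 0 < κ) (x y : ModelPlane κ) : dist x y ≤ π / √κ := by
  rw [← div_modelScale_le_iff hκ]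
  exact (mul_div_cancel_left₀ _ (modelScale_pos κ).ne').trans_le
    (UnitModelPlane.intrinsicDist_le_pi (sign_eq_pos_iff.mpr hκ) x y)

theorem dist_eq_of_modelVersine_eq {x y : ModelPlane κ} {l : ℝ} (hl : 0 ≤ l)
    (hκ : 0 < κ → l < π / √κ) (h : modelVersine κ (dist x y) = modelVersine κ l) : dist x y = l :=
  modelVersine_inj dist_nonneg hl (fun hpos => by
    rw [mul_div_assoc]; linarith [dist_le hpos x y, hκ hpos]) h

theorem neg_one_le_coords (hκ : κ < 0) (x : ModelPlane κ) : -1 ≤ x.coords 0 :=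
  UnitModelPlane.neg_one_le_coords (sign_neg hκ) x

theorem exists_coords_eq {P : Fin 3 → ℝ} (hP : versineForm (SignType.sign κ) P P = 0)
    (hκ : κ < 0 → -1 ≤ P 0) : ∃ x : ModelPlane κ, x.coords = P :=
  UnitModelPlane.exists_coords_eq hP fun h => hκ (sign_eq_neg_one_iff.mp h)

theorem exists_modelVersine_dist_eq {x y : ModelPlane κ} {u v : ℝ} (huv : u + v = dist x y)
    (hu : 0 ≤ modelSine κ u) (hv : 0 ≤ modelSine κ v) (hl : 0 < modelSine κ (u + v)) :
    ∃ p : ModelPlane κ, modelVersine κ (dist x p) = modelVersine κ u ∧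
      modelVersine κ (dist p y) = modelVersine κ v ∧ ∀ z,
      modelSine κ (u + v) * modelVersine κ (dist p z) =
        modelSine κ v * modelVersine κ (dist x z) + modelSine κ u * modelVersine κ (dist y z)
          - stewartDefect κ u v := by
  obtain ⟨P, hP⟩ : ∃ P : Fin 3 → ℝ, modelSine κ (u + v) • P =
      modelSine κ v • x.coords + modelSine κ u • y.coords - ![stewartDefect κ u v, 0, 0] :=
    ⟨_, smul_inv_smul₀ hl.ne' _⟩
  have hform := modelSine_mul_versineForm hP
  have hPx : versineForm (SignType.sign κ) P x.coords = modelVersine κ u := by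
    refine mul_left_cancel₀ hl.ne' ?_
    have hline := modelSine_mul_modelVersine_sub κ u v 0
    simp only [zero_sub, modelVersine_neg] at hline
    rw [hform, hline, ← modelVersine_dist, ← modelVersine_dist, dist_self, dist_comm y x, huv]
  have hPy : versineForm (SignType.sign κ) P y.coords = modelVersine κ v := by
    refine mul_left_cancel₀ hl.ne' ?_
    have hline := modelSine_mul_modelVersine_sub κ u v (u + v)
    rw [sub_self, add_sub_cancel_left] at hline
    rw [hform, hline, ← modelVersine_dist, ← modelVersine_dist, dist_self, huv]
  have hPP : versineForm (SignType.sign κ) P P = 0 := by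
    refine (mul_eq_zero.mp ?_).resolve_left hl.ne'
    rw [hform, versineForm_comm, hPx, versineForm_comm, hPy, stewartDefect]
    ring
  have hP0 (hneg : κ < 0) : -1 ≤ P 0 := by
    have h0 : _ * P 0 = _ * x.coords 0 + _ * y.coords 0 - stewartDefect κ u v := congrFun hP 0
    have hadd := modelSine_add κ u v
    rw [sign_neg hneg, SignType.coe_neg_one] at hadd
    refine le_of_mul_le_mul_left ?_ hl
    linarith [mul_le_mul_of_nonneg_left (x.neg_one_le_coords hneg) hv,
      mul_le_mul_of_nonneg_left (y.neg_one_le_coords hneg) hu]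
  obtain ⟨p, rfl⟩ := exists_coords_eq hPP hP0
  simp only [← modelVersine_dist] at hform hPx hPy
  refine ⟨p, dist_comm x p ▸ hPx, hPy, fun z => ?_⟩
  simpa only [modelVersine_dist] using hform z.coords

theorem exists_dist_eq_and_stewart {x y : ModelPlane κ} {u v : ℝ}
    (hu : 0 ≤ u) (hv : 0 ≤ v) (huv : u + v = dist x y) (hκ : 0 < κ → dist x y < π / √κ) :
    ∃ p : ModelPlane κ, dist x p = u ∧ dist p y = v ∧ ∀ z,
      modelSine κ (u + v) * modelVersine κ (dist p z) =
        modelSine κ v * modelVersine κ (dist x z) + modelSine κ u * modelVersine κ (dist y z)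
          - stewartDefect κ u v := by
  rw [← huv] at hκ
  rcases (add_nonneg hu hv).eq_or_lt with h0 | h0
  · obtain ⟨rfl, rfl⟩ : u = 0 ∧ v = 0 := by constructor <;> linarith
    exact ⟨x, dist_self x, h0.trans huv |>.symm, fun z => by simp [stewartDefect]⟩
  obtain ⟨p, hpu, hpv, hp⟩ := exists_modelVersine_dist_eq huv
    (modelSine_nonneg hu fun hpos => by linarith [hκ hpos])
    (modelSine_nonneg hv fun hpos => by linarith [hκ hpos]) (modelSine_pos h0 hκ)
  exact ⟨p, dist_eq_of_modelVersine_eq hu (fun hpos => by linarith [hκ hpos]) hpu,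
    dist_eq_of_modelVersine_eq hv (fun hpos => by linarith [hκ hpos]) hpv, hp⟩

theorem exists_modelVersine_triangle {α β γ : ℝ} (hα : 0 ≤ modelVersine κ α)
    (hγ : 0 ≤ modelVersine κ γ) (hβ : modelVersine κ β ≤ modelVersine κ (α + γ))
    (hβ' : modelVersine κ (α - γ) ≤ modelVersine κ β) :
    ∃ p q r : ModelPlane κ, modelVersine κ (dist p q) = modelVersine κ α ∧
      modelVersine κ (dist q r) = modelVersine κ β ∧
      modelVersine κ (dist r p) = modelVersine κ γ := by
  rw [modelVersine_add] at hβ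
  rw [modelVersine_sub] at hβ'
  obtain ⟨x, y, hx, hxy⟩ : ∃ x y, modelSine κ α * x = modelVersine κ α + modelVersine κ γ
      - SignType.sign κ * modelVersine κ α * modelVersine κ γ - modelVersine κ β ∧
      x ^ 2 + y ^ 2 = modelSine κ γ ^ 2 :=
    exists_mul_eq_and_sq_add_sq_eq (abs_le.mpr ⟨by linarith, by linarith⟩)
  obtain ⟨p, hp⟩ := exists_coords_eq (κ := κ) (P := ![0, 0, 0]) (by simp [versineForm]) (by simp)
  obtain ⟨q, hq⟩ := exists_coords_eq (κ := κ) (P := ![modelVersine κ α, modelSine κ α, 0])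
    (by
      simp only [versineForm, Matrix.cons_val]
      linear_combination -modelSine_sq κ α)
    (fun _ => (neg_one_lt_zero.trans_le hα).le)
  obtain ⟨r, hr⟩ := exists_coords_eq (κ := κ) (P := ![modelVersine κ γ, x, y])
    (by
      simp only [versineForm, Matrix.cons_val]
      linear_combination -modelSine_sq κ γ - hxy)
    (fun _ => (neg_one_lt_zero.trans_le hγ).le)
  refine ⟨p, q, r, ?_, ?_, ?_⟩ <;>
    simp only [modelVersine_dist, hp, hq, hr, versineForm, Matrix.cons_val]
  · ring
  · linear_combination -hx
  · ring

theorem exists_triangle {α β γ : ℝ} (hα : 0 ≤ α) (hβ : 0 ≤ β) (hγ : 0 ≤ γ) (hαβ : α ≤ β + γ)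
    (hβγ : β ≤ γ + α) (hγα : γ ≤ α + β) (hκ : 0 < κ → α + β + γ < 2 * π / √κ) :
    ∃ p q r : ModelPlane κ, dist p q = α ∧ dist q r = β ∧ dist r p = γ := by
  have hsub : |α - γ| ≤ β := abs_le.mpr ⟨by linarith, by linarith⟩
  have hα' (hpos : 0 < κ) : α < π / √κ := by linarith [mul_div_assoc 2 π √κ ▸ hκ hpos]
  have hβ' (hpos : 0 < κ) : β < π / √κ := by linarith [mul_div_assoc 2 π √κ ▸ hκ hpos]
  have hγ' (hpos : 0 < κ) : γ < π / √κ := by linarith [mul_div_assoc 2 π √κ ▸ hκ hpos]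
  have hβ_le : modelVersine κ β ≤ modelVersine κ (α + γ) := by
    rw [modelVersine_le_modelVersine_iff] <;> rw [abs_of_nonneg hβ, abs_of_nonneg (by positivity)]
    · linarith
    · exact fun hpos => by linarith [hκ hpos]
  have hle_β : modelVersine κ (α - γ) ≤ modelVersine κ β := by
    rw [modelVersine_le_modelVersine_iff] <;> rw [abs_of_nonneg hβ]
    · exact hsub
    · exact fun hpos => by linarith [hβ' hpos, mul_div_assoc 2 π √κ]
  obtain ⟨p, q, r, hpq, hqr, hrp⟩ := exists_modelVersine_triangle
    (modelVersine_nonneg fun hpos => (abs_of_nonneg hα).trans_le (hα' hpos).le)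
    (modelVersine_nonneg fun hpos => (abs_of_nonneg hγ).trans_le (hγ' hpos).le) hβ_le hle_β
  exact ⟨p, q, r, dist_eq_of_modelVersine_eq hα hα' hpq, dist_eq_of_modelVersine_eq hβ hβ' hqr,
    dist_eq_of_modelVersine_eq hγ hγ' hrp⟩

end ModelPlane

theorem IsSmallTriangle.exists_isComparisonTriangle {X : Type*} [MetricSpace X] {a : Fin 3 → X}
    (ha : IsSmallTriangle κ a) : ∃ b : Fin 3 → ModelPlane κ, IsComparisonTriangle a b := by
  obtain ⟨p, q, r, hpq, hqr, hrp⟩ := ModelPlane.exists_triangle (κ := κ) (dist_nonneg (x := a 0))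
    dist_nonneg (dist_nonneg (x := a 2))
    (by linarith [dist_triangle_right (a 0) (a 1) (a 2), dist_comm (a 0) (a 2)])
    (by linarith [dist_triangle_right (a 1) (a 2) (a 0), dist_comm (a 1) (a 0)])
    (by linarith [dist_triangle_right (a 2) (a 0) (a 1), dist_comm (a 2) (a 1)]) ha
  refine ⟨![p, q, r], fun i j => ?_⟩
  fin_cases i <;> fin_cases j <;>
    simp [hpq, hqr, hrp, dist_comm q p, dist_comm r q, dist_comm p r, dist_comm (a 1) (a 0),
      dist_comm (a 2) (a 1), dist_comm (a 0) (a 2)]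

end ModelPlane

section Geodesics

variable {X : Type*} [MetricSpace X] {κ : ℝ} {x y z p : X} {γ : ℝ → X}

/-- The union of all geodesic segments from `x` to `y`. -/
def geodesicPoints (x y : X) : Set X := {p | ∃ γ, IsGeodesic γ x y ∧ p ∈ γ '' Set.Icc 0 1}

theorem IsGeodesic.mem_geodesicPoints (h : IsGeodesic γ x y) {t : ℝ} (ht : t ∈ Set.Icc (0 : ℝ) 1) :
    γ t ∈ geodesicPoints x y :=
  ⟨γ, h, Set.mem_image_of_mem γ ht⟩

theorem IsGeodesic.dist_left (h : IsGeodesic γ x y) {t : ℝ} (ht : t ∈ Set.Icc (0 : ℝ) 1) :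
    dist x (γ t) = dist x y * t := by
  conv_lhs => rw [← h.1]
  rw [h.2.2 0 (Set.left_mem_Icc.mpr zero_le_one) t ht, zero_sub, abs_neg, abs_of_nonneg ht.1]

theorem IsGeodesic.dist_right (h : IsGeodesic γ x y) {t : ℝ} (ht : t ∈ Set.Icc (0 : ℝ) 1) :
    dist (γ t) y = dist x y * (1 - t) := by
  conv_lhs => rw [← h.2.1]
  rw [h.2.2 t ht 1 (Set.right_mem_Icc.mpr zero_le_one), abs_sub_comm,
    abs_of_nonneg (sub_nonneg.mpr ht.2)]

theorem IsGeodesic.continuousOn (h : IsGeodesic γ x y) : ContinuousOn γ (Set.Icc 0 1) :=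
  (LipschitzOnWith.of_dist_le_mul (K := ⟨dist x y, dist_nonneg⟩) fun s hs t ht =>
    (h.2.2 s hs t ht).le).continuousOn

theorem IsGeodesic.exists_dist_eq (h : IsGeodesic γ x y) {r : ℝ} (hr : 0 ≤ r) (hr' : r ≤ dist x y) :
    ∃ p ∈ geodesicPoints x y, dist x p = r := by
  have ht : r / dist x y ∈ Set.Icc (0 : ℝ) 1 :=
    ⟨div_nonneg hr dist_nonneg, div_le_one_of_le₀ hr' dist_nonneg⟩
  refine ⟨_, h.mem_geodesicPoints ht, ?_⟩
  rw [h.dist_left ht]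
  exact mul_div_cancel_of_imp' fun h0 => le_antisymm (hr'.trans h0.le) hr

theorem dist_add_dist_of_mem_geodesicPoints (hp : p ∈ geodesicPoints x y) :
    dist x p + dist p y = dist x y := by
  obtain ⟨γ, h, t, ht, rfl⟩ := hp
  rw [h.dist_left ht, h.dist_right ht]
  ring

theorem IsSmallTriangle.dist_lt {a : Fin 3 → X} (ha : IsSmallTriangle κ a) (hκ : 0 < κ)
    (i j : Fin 3) : dist (a i) (a j) < π / √κ := by
  have h := ha hκ
  rw [mul_div_assoc] at h
  have h01 := dist_triangle_right (a 0) (a 1) (a 2)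
  have h12 := dist_triangle_right (a 1) (a 2) (a 0)
  have h20 := dist_triangle_right (a 2) (a 0) (a 1)
  have hpos : 0 < π / √κ := by positivity
  rw [dist_comm (a 0) (a 2)] at h01
  rw [dist_comm (a 1) (a 0)] at h12
  rw [dist_comm (a 2) (a 1)] at h20
  fin_cases i <;> fin_cases j <;>
    simp only [Fin.zero_eta, Fin.mk_one, Fin.reduceFinMk, dist_self, dist_comm (a 1) (a 0),
      dist_comm (a 2) (a 1), dist_comm (a 0) (a 2)] <;> linarith

theorem IsSmallTriangle.subdivide_left (h : IsSmallTriangle κ ![x, y, z])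
    (hp : p ∈ geodesicPoints x y) : IsSmallTriangle κ ![z, p, x] := fun hκ => by
  have h' : dist x y + dist y z + dist z x < 2 * π / √κ := h hκ
  change dist z p + dist p x + dist x z < _
  linarith [dist_triangle_left z p y, dist_add_dist_of_mem_geodesicPoints hp, dist_comm p x,
    dist_comm x z, dist_comm p y]

theorem IsSmallTriangle.subdivide_right (h : IsSmallTriangle κ ![x, y, z])
    (hp : p ∈ geodesicPoints x y) : IsSmallTriangle κ ![z, p, y] := fun hκ => by
  have h' : dist x y + dist y z + dist z x < 2 * π / √κ := h hκ
  change dist z p + dist p y + dist y z < _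
  linarith [dist_triangle z x p, dist_add_dist_of_mem_geodesicPoints hp]

end Geodesics

section Comparison

variable {X : Type*} [MetricSpace X] {κ : ℝ} {a : Fin 3 → X} {b : Fin 3 → ModelPlane κ}

theorem IsComparisonTriangle.isSmallTriangle (hb : IsComparisonTriangle a b)
    (ha : IsSmallTriangle κ a) : IsSmallTriangle κ b := fun hκ => by
  rw [hb, hb, hb]
  exact ha hκ

theorem IsComparisonTriangle.dist_le_two_mul (hb : IsComparisonTriangle a b) {o : ModelPlane κ}
    {R : ℝ} (ho : ∀ i, dist o (b i) ≤ R) (i j : Fin 3) : dist (a i) (a j) ≤ 2 * R := by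
  rw [← hb]
  linarith [dist_triangle_left (b i) (b j) o, ho i, ho j]

theorem IsSmallTriangle.modelVersine_dist_sub_le (hb : IsSmallTriangle κ b) {p o : ModelPlane κ}
    (hp : dist (b 0) p + dist p (b 1) = dist (b 0) (b 1)) {r : ℝ} (hr : dist o (b 2) ≤ r)
    (hr' : r ≤ dist p (b 2)) :
    modelVersine κ (dist p (b 2) - r) ≤ modelVersine κ (dist p o) := by
  rw [modelVersine_le_modelVersine_iff] <;>
    rw [abs_of_nonneg (sub_nonneg.mpr hr'), abs_of_nonneg dist_nonneg]
  · linarith [dist_triangle p o (b 2)]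
  · intro hκ
    have hperim := hb hκ
    have hle := ModelPlane.dist_le hκ p o
    rw [mul_div_assoc] at hperim ⊢
    linarith [dist_triangle_left p (b 2) (b 0), dist_triangle p (b 1) (b 2),
      dist_comm (b 2) (b 0), dist_nonneg (x := o) (y := b 2)]

end Comparison

section CAT

variable {X : Type*} [MetricSpace X] {κ : ℝ}

namespace IsCAT

theorem dist_le_of_comparison (hX : IsCAT κ X) {a : Fin 3 → X} (ha : IsSmallTriangle κ a)
    {b : Fin 3 → ModelPlane κ} (hb : IsComparisonTriangle a b) {p : X}
    (hp : p ∈ geodesicPoints (a 0) (a 1)) {p' : ModelPlane κ}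
    (hp' : IsComparisonPoint (a 0) (a 1) p (b 0) (b 1) p') : dist p (a 2) ≤ dist p' (b 2) := by
  obtain ⟨γ, hγ, t, ht, rfl⟩ := hp
  obtain ⟨γ₁, hγ₁⟩ := hX.exists_geodesic (a 1) (a 2) fun hκ => ha.dist_lt hκ 1 2
  obtain ⟨γ₂, hγ₂⟩ := hX.exists_geodesic (a 2) (a 0) fun hκ => ha.dist_lt hκ 2 0
  have h : dist (γ t) (γ₂ 0) ≤ dist p' (b 2) :=
    hX.comparison a ![γ, γ₁, γ₂] (fun i => by fin_cases i; exacts [hγ, hγ₁, hγ₂]) ha b hb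
      0 2 t ht 0 (Set.left_mem_Icc.mpr zero_le_one) p' (b 2) hp'
      ⟨by
        change dist (b 2) (b 2) = dist (a 2) (γ₂ 0)
        rw [hγ₂.1, dist_self, dist_self],
      by
        change dist (b 2) (b 0) = dist (γ₂ 0) (a 0)
        rw [hγ₂.1, hb]⟩
  rwa [hγ₂.1] at h

theorem modelSine_mul_modelVersine_dist_le (hX : IsCAT κ X) {x y z p : X}
    (hs : IsSmallTriangle κ ![x, y, z]) (hp : p ∈ geodesicPoints x y) :
    modelSine κ (dist x p + dist p y) * modelVersine κ (dist p z) ≤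
      modelSine κ (dist p y) * modelVersine κ (dist x z)
        + modelSine κ (dist x p) * modelVersine κ (dist y z)
        - stewartDefect κ (dist x p) (dist p y) := by
  obtain ⟨b, hb⟩ := hs.exists_isComparisonTriangle
  have hadd := dist_add_dist_of_mem_geodesicPoints hp
  have hb01 : dist (b 0) (b 1) = dist x y := hb 0 1
  have hxy (hκ : 0 < κ) : dist x y < π / √κ := hs.dist_lt hκ 0 1
  obtain ⟨p', hp0, hp1, hstewart⟩ := ModelPlane.exists_dist_eq_and_stewart dist_nonneg dist_nonneg
    (hadd.trans hb01.symm) fun hκ => hb01 ▸ hxy hκ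
  have hle : dist p z ≤ dist p' (b 2) := hX.dist_le_of_comparison hs hb hp ⟨hp0, hp1⟩
  have hmono : modelVersine κ (dist p z) ≤ modelVersine κ (dist p' (b 2)) := by
    rw [modelVersine_le_modelVersine_iff] <;>
      rw [abs_of_nonneg dist_nonneg, abs_of_nonneg dist_nonneg]
    · exact hle
    · intro hκ
      have hpz : dist z p < π / √κ := (hs.subdivide_left hp).dist_lt hκ 0 1
      rw [mul_div_assoc]
      linarith [ModelPlane.dist_le hκ p' (b 2), dist_comm z p]
  refine (mul_le_mul_of_nonneg_left hmono
    (modelSine_nonneg (by positivity) fun hκ => (hadd.trans_lt (hxy hκ)).le)).trans_eq ?_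
  rw [hstewart, hb 0 2, hb 1 2]
  rfl

theorem tendsto_dist_of_mem_geodesicPoints (hX : IsCAT κ X) {T : Type*} {l : Filter T} {q p₀ y₀ : X}
    {p y : T → X} (hy₀ : y₀ ∈ geodesicPoints q p₀) (hy : ∀ t, y t ∈ geodesicPoints q (p t))
    (hne : q ≠ p₀) (hκ : 0 < κ → dist q p₀ < π / √κ) (hp : Tendsto p l (𝓝 p₀))
    (hqy : Tendsto (fun t => dist q (y t)) l (𝓝 (dist q y₀))) :
    Tendsto (fun t => dist (y t) y₀) l (𝓝 0) := by
  have hadd₀ := dist_add_dist_of_mem_geodesicPoints hy₀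
  have hadd (t : T) := dist_add_dist_of_mem_geodesicPoints (hy t)
  have hqp : Tendsto (fun t => dist q (p t)) l (𝓝 (dist q p₀)) := tendsto_const_nhds.dist hp
  have hpy : Tendsto (fun t => dist (p t) y₀) l (𝓝 (dist p₀ y₀)) := hp.dist tendsto_const_nhds
  have hyp : Tendsto (fun t => dist (y t) (p t)) l (𝓝 (dist y₀ p₀)) := by
    simpa only [← hadd, ← hadd₀, add_sub_cancel_left] using hqp.sub hqy
  have hsmall : ∀ᶠ t in l, IsSmallTriangle κ ![q, p t, y₀] := by
    by_cases hpos : 0 < κ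
    · refine (((hqp.add hpy).add_const (dist y₀ q)).eventually_lt_const ?_).mono fun t ht _ => ht
      rw [mul_div_assoc]
      linarith [hκ hpos, dist_comm y₀ q, dist_comm y₀ p₀]
    · exact .of_forall fun t h => absurd h hpos
  have hrange : ∀ᶠ t in l, 0 < κ → |dist (y t) y₀| ≤ π / √κ := hsmall.mono fun t ht hpos => by
    rw [abs_of_nonneg dist_nonneg, dist_comm]
    exact ((ht.subdivide_left (hy t)).dist_lt hpos 0 1).le
  have hsine_pos : 0 < modelSine κ (dist q p₀) := modelSine_pos (dist_pos.mpr hne) hκ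
  have hsine : Tendsto (fun t => modelSine κ (dist q (p t))) l (𝓝 (modelSine κ (dist q p₀))) :=
    ((continuous_modelSine κ).tendsto _).comp hqp
  have hle : ∀ᶠ t in l, modelVersine κ (dist (y t) y₀) ≤
      (modelSine κ (dist (y t) (p t)) * modelVersine κ (dist q y₀)
        + modelSine κ (dist q (y t)) * modelVersine κ (dist (p t) y₀)
        - stewartDefect κ (dist q (y t)) (dist (y t) (p t))) / modelSine κ (dist q (p t)) := by
    filter_upwards [hsmall, hsine.eventually_const_lt hsine_pos] with t ht hpos
    rw [le_div_iff₀' hpos, ← hadd t]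
    exact hX.modelSine_mul_modelVersine_dist_le ht (hy t)
  refine tendsto_zero_of_tendsto_modelVersine hrange
    (squeeze_zero' (hrange.mono fun t => modelVersine_nonneg) hle ?_)
  have hs {f : T → ℝ} {c : ℝ} (hf : Tendsto f l (𝓝 c)) :=
    ((continuous_modelSine κ).tendsto c).comp hf
  have hv {f : T → ℝ} {c : ℝ} (hf : Tendsto f l (𝓝 c)) :=
    ((continuous_modelVersine κ).tendsto c).comp hf
  -- The bound tends to the Stewart expression of `y₀` as a point of `[q, p₀]`, which vanishes.
  have hlim := ((((hs hyp).mul_const (modelVersine κ (dist q y₀))).add ((hs hqy).mul (hv hpy))).sub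
    (((hs hyp).mul (hv hqy)).add ((hs hqy).mul (hv hyp)))).div hsine hsine_pos.ne'
  rw [dist_comm p₀ y₀, sub_self, zero_div] at hlim
  exact hlim

theorem continuous_of_mem_geodesicPoints (hX : IsCAT κ X) {T : Type*} [TopologicalSpace T] {q : X}
    {p y : T → X} (hp : Continuous p) (hκ : ∀ t, 0 < κ → dist q (p t) < π / √κ)
    (hy : ∀ t, y t ∈ geodesicPoints q (p t)) (hqy : Continuous fun t => dist q (y t)) :
    Continuous y := by
  refine continuous_iff_continuousAt.mpr fun t₀ => tendsto_iff_dist_tendsto_zero.mpr ?_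
  rcases eq_or_ne q (p t₀) with h0 | hne
  · have hy₀ : q = y t₀ := by
      have hadd := dist_add_dist_of_mem_geodesicPoints (hy t₀)
      rw [← h0, dist_self, dist_comm (y t₀), ← two_mul] at hadd
      exact dist_eq_zero.mp (by linarith)
    simpa only [← hy₀, dist_self, dist_comm q] using hqy.tendsto t₀
  · exact hX.tendsto_dist_of_mem_geodesicPoints (hy t₀) hy hne (hκ t₀) (hp.tendsto t₀)
      (hqy.tendsto t₀)

theorem modelSine_mul_weighted_modelVersine_dist_le (hX : IsCAT κ X) {a : Fin 3 → X}
    (ha : IsSmallTriangle κ a) {p y : X} (hp : p ∈ geodesicPoints (a 0) (a 1))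
    (hy : y ∈ geodesicPoints (a 2) p) :
    modelSine κ (dist (a 2) y + dist y p) *
        (modelSine κ (dist p (a 1)) * modelVersine κ (dist y (a 0))
          + modelSine κ (dist (a 0) p) * modelVersine κ (dist y (a 1))) ≤
      modelSine κ (dist y p) *
          (modelSine κ (dist p (a 1)) * modelVersine κ (dist (a 2) (a 0))
            + modelSine κ (dist (a 0) p) * modelVersine κ (dist (a 2) (a 1)))
        + modelSine κ (dist (a 2) y) * stewartDefect κ (dist (a 0) p) (dist p (a 1))
        - (modelSine κ (dist (a 0) p) + modelSine κ (dist p (a 1)))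
          * stewartDefect κ (dist (a 2) y) (dist y p) := by
  have ha' : IsSmallTriangle κ ![a 0, a 1, a 2] := ha
  have hleft := hX.modelSine_mul_modelVersine_dist_le (ha'.subdivide_left hp) hy
  have hright := hX.modelSine_mul_modelVersine_dist_le (ha'.subdivide_right hp) hy
  have hu : 0 ≤ modelSine κ (dist (a 0) p) := modelSine_nonneg dist_nonneg fun hκ =>
    dist_comm p (a 0) ▸ ((ha'.subdivide_left hp).dist_lt hκ 1 2).le
  have hv : 0 ≤ modelSine κ (dist p (a 1)) := modelSine_nonneg dist_nonneg fun hκ =>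
    ((ha'.subdivide_right hp).dist_lt hκ 1 2).le
  rw [dist_comm p (a 0)] at hleft
  simp only [stewartDefect] at hleft hright ⊢
  linear_combination modelSine κ (dist p (a 1)) * hleft + modelSine κ (dist (a 0) p) * hright

theorem weighted_modelVersine_dist_le (hX : IsCAT κ X) {a : Fin 3 → X} (ha : IsSmallTriangle κ a)
    {b : Fin 3 → ModelPlane κ} (hb : IsComparisonTriangle a b) {p y : X}
    (hp : p ∈ geodesicPoints (a 0) (a 1)) (hy : y ∈ geodesicPoints (a 2) p) (hne : a 2 ≠ p)
    {o : ModelPlane κ} (ho : dist o (b 2) ≤ dist (a 2) y) :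
    modelSine κ (dist p (a 1)) * modelVersine κ (dist y (a 0))
        + modelSine κ (dist (a 0) p) * modelVersine κ (dist y (a 1)) ≤
      modelSine κ (dist p (a 1)) * modelVersine κ (dist (b 0) o)
        + modelSine κ (dist (a 0) p) * modelVersine κ (dist (b 1) o) := by
  have ha' : IsSmallTriangle κ ![a 0, a 1, a 2] := ha
  have hadd := dist_add_dist_of_mem_geodesicPoints hp
  have hadd' := dist_add_dist_of_mem_geodesicPoints hy
  have hdist (hκ : 0 < κ) : dist (a 0) (a 1) < π / √κ := ha.dist_lt hκ 0 1
  have hdist' (hκ : 0 < κ) : dist (a 2) p < π / √κ := (ha'.subdivide_left hp).dist_lt hκ 0 1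
  have hb01 : dist (b 0) (b 1) = dist (a 0) (a 1) := hb 0 1
  obtain ⟨p', hp0, hp1, hstewart⟩ := ModelPlane.exists_dist_eq_and_stewart dist_nonneg dist_nonneg
    (hadd.trans hb01.symm) fun hκ => hb01 ▸ hdist hκ
  have hcat : dist (a 2) p ≤ dist p' (b 2) :=
    dist_comm p (a 2) ▸ hX.dist_le_of_comparison ha hb hp ⟨hp0, hp1⟩
  have hnear : modelVersine κ (dist p' (b 2) - dist (a 2) y) ≤ modelVersine κ (dist p' o) :=
    (hb.isSmallTriangle ha).modelVersine_dist_sub_le (by rw [hp0, hp1, hadd, hb01]) ho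
      (by linarith [dist_nonneg (x := y) (y := p)])
  have hexcess : 0 ≤ modelVersine κ (dist p' (b 2) - (dist (a 2) y + dist y p)) := by
    refine modelVersine_nonneg fun hκ => ?_
    rw [hadd', abs_of_nonneg (sub_nonneg.mpr hcat)]
    linarith [ModelPlane.dist_le hκ p' (b 2), dist_nonneg (x := a 2) (y := p)]
  have hS : 0 ≤ modelSine κ (dist (a 0) p + dist p (a 1)) :=
    modelSine_nonneg (by positivity) fun hκ => (hadd.trans_lt (hdist hκ)).le
  have hρ : 0 ≤ modelSine κ (dist (a 2) y) := modelSine_nonneg dist_nonneg fun hκ => by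
    linarith [hdist' hκ, dist_nonneg (x := y) (y := p)]
  have hh : 0 < modelSine κ (dist (a 2) y + dist y p) :=
    modelSine_pos (hadd'.symm ▸ dist_pos.mpr hne) fun hκ => hadd'.trans_lt (hdist' hκ)
  have hupper := hX.modelSine_mul_weighted_modelVersine_dist_le ha hp hy
  rw [← hb 2 0, ← hb 2 1, dist_comm (b 2), dist_comm (b 2)] at hupper
  refine le_of_mul_le_mul_left ?_ hh
  -- Stewart's theorem for `p'`, at `b 2` and at `o`, reduces the claim to a comparison along a
  -- line, where `hexcess` has the right sign; the defect terms cancel.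
  linear_combination hupper - modelSine κ (dist y p) * hstewart (b 2)
    + modelSine κ (dist (a 2) y + dist y p) * hstewart o
    + modelSine κ (dist (a 0) p + dist p (a 1)) * modelSine κ (dist (a 2) y + dist y p) * hnear
    + modelSine κ (dist (a 0) p + dist p (a 1)) * modelSine κ (dist (a 2) y) * hexcess
    - modelSine κ (dist (a 0) p + dist p (a 1)) *
      modelSine_mul_modelVersine_sub κ (dist (a 2) y) (dist y p) (dist p' (b 2))
    + modelSine_sub_mul_stewartDefect κ (dist (a 2) y) (dist y p) (dist (a 0) p) (dist p (a 1))

theorem dist_le_or_dist_le (hX : IsCAT κ X) {a : Fin 3 → X} (ha : IsSmallTriangle κ a)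
    {b : Fin 3 → ModelPlane κ} (hb : IsComparisonTriangle a b) {p y : X}
    (hp : p ∈ geodesicPoints (a 0) (a 1)) (hy : y ∈ geodesicPoints (a 2) p)
    {o : ModelPlane κ} (ho : ∀ i, dist o (b i) ≤ dist (a 2) y) :
    dist y (a 0) ≤ dist (a 2) y ∨ dist y (a 1) ≤ dist (a 2) y := by
  have ha' : IsSmallTriangle κ ![a 0, a 1, a 2] := ha
  have hadd' := dist_add_dist_of_mem_geodesicPoints hy
  have hdiam := hb.dist_le_two_mul ho
  have hu (hκ : 0 < κ) : dist p (a 0) < π / √κ := (ha'.subdivide_left hp).dist_lt hκ 1 2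
  have hv (hκ : 0 < κ) : dist p (a 1) < π / √κ := (ha'.subdivide_right hp).dist_lt hκ 1 2
  by_contra! hcon
  have hne : a 2 ≠ p := by
    rintro rfl
    rw [dist_self] at hadd'
    linarith [hdiam 2 0, dist_triangle_left y (a 0) (a 2), dist_comm y (a 2), hcon.1]
  have hpos : 0 < dist (a 0) p := by
    refine dist_pos.mpr ?_
    rintro rfl
    linarith [hdiam 2 0, hcon.1]
  have hlt {i : Fin 3} (hi : dist (a 2) y < dist y (a i)) (hyi : 0 < κ → dist y (a i) < π / √κ) :
      modelVersine κ (dist (b i) o) < modelVersine κ (dist y (a i)) := by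
    refine modelVersine_lt_modelVersine ?_ fun hκ => ?_ <;>
      rw [abs_of_nonneg dist_nonneg, abs_of_nonneg dist_nonneg]
    · exact (dist_comm o (b i) ▸ ho i).trans_lt hi
    · rw [mul_div_assoc]
      linarith [hyi hκ, ModelPlane.dist_le hκ (b i) o]
  have h0 := hlt hcon.1 fun hκ => dist_comm y (a 0) ▸
    ((ha'.subdivide_left hp).subdivide_left hy).dist_lt hκ 0 1
  have h1 := hlt hcon.2 fun hκ => dist_comm y (a 1) ▸
    ((ha'.subdivide_right hp).subdivide_left hy).dist_lt hκ 0 1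
  have hweighted := hX.weighted_modelVersine_dist_le ha hb hp hy hne (ho 2)
  refine hweighted.not_gt (add_lt_add_of_le_of_lt ?_ ?_)
  · exact mul_le_mul_of_nonneg_left h0.le (modelSine_nonneg dist_nonneg fun hκ => (hv hκ).le)
  · exact mul_lt_mul_of_pos_left h1 (modelSine_pos hpos fun hκ => dist_comm p (a 0) ▸ hu hκ)

theorem dist_le_or_dist_le_of_eq_min (hX : IsCAT κ X) {a : Fin 3 → X} (ha : IsSmallTriangle κ a)
    {b : Fin 3 → ModelPlane κ} (hb : IsComparisonTriangle a b) {o : ModelPlane κ} {R : ℝ}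
    (ho : ∀ i, dist o (b i) ≤ R) {p y : X} (hp : p ∈ geodesicPoints (a 0) (a 1))
    (hy : y ∈ geodesicPoints (a 2) p) (hqy : dist (a 2) y = min R (dist (a 2) p)) :
    dist y (a 0) ≤ R ∨ dist y (a 1) ≤ R := by
  rcases le_total R (dist (a 2) p) with hR | hR
  · rw [min_eq_left hR] at hqy
    subst hqy
    exact hX.dist_le_or_dist_le ha hb hp hy ho
  · rw [min_eq_right hR] at hqy
    have hadd := dist_add_dist_of_mem_geodesicPoints hp
    have hyp := dist_add_dist_of_mem_geodesicPoints hy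
    have hdiam := hb.dist_le_two_mul ho 0 1
    by_contra! hcon
    linarith [dist_triangle y p (a 0), dist_triangle y p (a 1), dist_comm p (a 0)]

theorem exists_continuous_mem_geodesicPoints (hX : IsCAT κ X) {T : Type*} [TopologicalSpace T]
    {q : X} {p : T → X} (hp : Continuous p) (hκ : ∀ t, 0 < κ → dist q (p t) < π / √κ) {R : ℝ}
    (hR : 0 ≤ R) :
    ∃ y : T → X, Continuous y ∧
      ∀ t, y t ∈ geodesicPoints q (p t) ∧ dist q (y t) = min R (dist q (p t)) := by
  have hex (t : T) : ∃ y ∈ geodesicPoints q (p t), dist q y = min R (dist q (p t)) := by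
    obtain ⟨σ, hσ⟩ := hX.exists_geodesic q (p t) (hκ t)
    exact hσ.exists_dist_eq (le_min hR dist_nonneg) (min_le_right _ _)
  choose y hy hqy using hex
  refine ⟨y, hX.continuous_of_mem_geodesicPoints hp hκ hy ?_, fun t => ⟨hy t, hqy t⟩⟩
  simp only [hqy]
  exact continuous_const.min (continuous_const.dist hp)

theorem exists_forall_dist_le (hX : IsCAT κ X) {a : Fin 3 → X} (ha : IsSmallTriangle κ a)
    {b : Fin 3 → ModelPlane κ} (hb : IsComparisonTriangle a b) {o : ModelPlane κ} {R : ℝ}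
    (ho : ∀ i, dist o (b i) ≤ R) : ∃ y : X, ∀ i, dist y (a i) ≤ R := by
  have ha' : IsSmallTriangle κ ![a 0, a 1, a 2] := ha
  have hdiam := hb.dist_le_two_mul ho
  obtain ⟨γ, hγ⟩ := hX.exists_geodesic (a 0) (a 1) fun hκ => ha.dist_lt hκ 0 1
  have hp (s : Set.Icc (0 : ℝ) 1) : γ s ∈ geodesicPoints (a 0) (a 1) := hγ.mem_geodesicPoints s.2
  obtain ⟨y, hyc, hy⟩ := hX.exists_continuous_mem_geodesicPoints
    (continuousOn_iff_continuous_domRestrict.mp hγ.continuousOn)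
    (fun s hκ => (ha'.subdivide_left (hp s)).dist_lt hκ 0 1) (dist_nonneg.trans (ho 0))
  have hcover (s : Set.Icc (0 : ℝ) 1) : dist (y s) (a 0) ≤ R ∨ dist (y s) (a 1) ≤ R :=
    hX.dist_le_or_dist_le_of_eq_min ha hb ho (hp s) (hy s).1 (hy s).2
  have hend (s : Set.Icc (0 : ℝ) 1) {i : Fin 3} (hs : γ s = a i) : dist (y s) (a i) ≤ R := by
    obtain ⟨hys, hqy⟩ := hy s
    have hadd := dist_add_dist_of_mem_geodesicPoints hys
    simp only [Set.domRestrict_apply, hs] at hadd hqy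
    rcases min_choice R (dist (a 2) (a i)) with h | h <;>
      linarith [hdiam 2 i, hdiam 2 2, dist_self (a 2)]
  obtain ⟨s, -, hs0, hs1⟩ := isPreconnected_closed_iff.mp
    (isPreconnected_univ (α := Set.Icc (0 : ℝ) 1)) _ _
    (isClosed_le (hyc.dist continuous_const) continuous_const)
    (isClosed_le (hyc.dist continuous_const) continuous_const)
    (fun s _ => hcover s) ⟨0, trivial, hend 0 hγ.1⟩ ⟨1, trivial, hend 1 hγ.2.1⟩
  have hs2 : dist (y s) (a 2) ≤ R := by
    rw [dist_comm, (hy s).2]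
    exact min_le_left _ _
  exact ⟨y s, fun i => by fin_cases i; exacts [hs0, hs1, hs2]⟩

end IsCAT

end CAT

end

theorem mainTheorem4 (κ : ℝ) (X : Type*) [MetricSpace X] (hX : IsCAT κ X) : CurvLE X κ := by
  intro a ha b hb
  have : Nonempty (ModelPlane κ) := ⟨b 0⟩
  refine le_ciInf fun o => ?_
  obtain ⟨y, hy⟩ := hX.exists_forall_dist_le ha hb (o := o)
    (R := max (dist o (b 0)) (max (dist o (b 1)) (dist o (b 2)))) fun i => by fin_cases i <;> simp
  exact (ciInf_le ⟨0, Set.forall_mem_range.mpr fun x => le_max_of_le_left dist_nonneg⟩ y).trans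
    (max_le (hy 0) (max_le (hy 1) (hy 2)))
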